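/- Let $X=(X_t)_{t\ge 0}$ be a spectrally negative Lévy process under a probability $\mathsf P$, in a filtration $(\mathcal F_t)_{t\ge 0}$: $X$ is càdlàg, adapted, starts at $0$, has stationary increments that are independent relative to $(\mathcal F_t)$, has no positive jumps, and its paths are not monotone. Let $\psi(\lambda)=\log\mathsf P[e^{\lambda X_1}]$, $\lambda\ge 0$, be its Laplace exponent, and for $p\in[0,\infty)$ let $\Phi(p)$ be the largest $\lambda\ge 0$ with $\psi(\lambda)=p$. For $p\in[0,\infty)$ let $W^{(p)}:\mathbb R\to[0,\infty)$ be the $p$-scale function of $X$: the unique function that vanishes on $(-\infty,0)$, is continuous on $[0,\infty)$ and satisfies $\int_0^\infty e^{-\lambda x}W^{(p)}(x)\,\mathrm dx=\frac1{\psi(\lambda)-p}$ for $\lambda\in(\Phi(p),\infty)$. For $\alpha\in\mathbb R$ and $p,q\in[0,\infty)$ put $\mathcal W^{(q)}_{\alpha,p}(y):=\mathcal W(\log y)$, $y\in(0,\infty)$, where $\mathcal W:\mathbb R\to\mathbb R$ is the unique Borel measurable and locally bounded function with $$\mathcal W=W^{(p)}+q\,W^{(p)}\star\big(e^{\alpha\,\cdot}\,\mathbf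 1_{[0,\infty)}\,\mathcal W\big),\qquad (f\star g)(x)=\int_{-\infty}^\infty f(u)g(x-u)\,\mathrm du .$$ For $\theta\in[0,\infty)$ let $\mathsf P^\theta$ be the Esscher transform of $\mathsf P$, i.e. a measure with $\frac{\mathrm d\mathsf P^\theta|_{\mathcal F_t}}{\mathrm d\mathsf P|_{\mathcal F_t}}=e^{\theta (X_t-X_0)-\psi(\theta)t}$ for all $t\ge 0$ (assumed to exist on the underlying filtered space), and let a left subscript $\theta$ indicate that a quantity is computed for the process $X$ under $\mathsf P^\theta$. **Proposition.** Let $\alpha\in\mathbb R$ and $p,q\in[0,\infty)$. For every $\theta\in[0,\Phi(p)]$ one has $p-\psi(\theta)\ge 0$ and $$\mathcal W^{(q)}_{\alpha,p}(y)={}_\theta\mathcal W^{(q)}_{\alpha,\,p-\psi(\theta)}(y)\;y^\theta,\qquad y\in(0,\infty).$$ -/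

import Mathlib

open MeasureTheory ProbabilityTheory Filter Topology
open scoped NNReal ENNReal Convolution

namespace PssMp

/-- `X` is, under the probability `P`, a spectrally negative Lévy process in the filtration `F`:
an adapted process that starts at zero, has increments that are stationary and independent
relative to `F`, and whose paths are càdlàg, without positive jumps, and non-monotone. -/
structure IsSpectrallyNegativeLevy {Ω : Type*} {mΩ : MeasurableSpace Ω}
    (F : Filtration ℝ≥0 mΩ) (X : ℝ≥0 → Ω → ℝ) (P : Measure Ω) : Prop where
  adapted : ∀ t, Measurable[F t] (X t)
  start_zero : ∀ᵐ ω ∂P, X 0 ω = 0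
  /-- The increment over `[t, t + s]` is independent of `F t`. -/
  indep_increments : ∀ t s,
    Indep (F t) (MeasurableSpace.comap (fun ω ↦ X (t + s) ω - X t ω) inferInstance) P
  stationary_increments : ∀ t s,
    IdentDistrib (fun ω ↦ X (t + s) ω - X t ω) (fun ω ↦ X s ω - X 0 ω) P P
  right_continuous : ∀ᵐ ω ∂P, ∀ t, Tendsto (fun u ↦ X u ω) (𝓝[>] t) (𝓝 (X t ω))
  /-- At every time `t > 0` the path has a finite left limit, and the jump at `t` is not
  positive. -/
  left_limits_no_positive_jumps : ∀ᵐ ω ∂P, ∀ t, 0 < t →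
    ∃ l : ℝ, Tendsto (fun u ↦ X u ω) (𝓝[<] t) (𝓝 l) ∧ X t ω ≤ l
  not_increasing : ¬ ∀ᵐ ω ∂P, Monotone fun t ↦ X t ω
  not_decreasing : ¬ ∀ᵐ ω ∂P, Antitone fun t ↦ X t ω

section

variable {Ω : Type*} {mΩ : MeasurableSpace Ω}

/-- The Laplace exponent `ψ(r) = log P[e^{r X₁}]` of `X` under `P`. -/
noncomputable def laplaceExponent (X : ℝ≥0 → Ω → ℝ) (P : Measure Ω) (r : ℝ) : ℝ :=
  cgf (X 1) P r

/-- `Φ(q)`, the largest `r ≥ 0` with `ψ(r) = q`. For `q ≥ 0` this is the inverse of `ψ`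
restricted to `[Φ(0), ∞)`, where `Φ(0)` is the largest zero of `ψ`. -/
noncomputable def laplaceInverse (X : ℝ≥0 → Ω → ℝ) (P : Measure Ω) (q : ℝ) : ℝ :=
  sSup {r : ℝ | 0 ≤ r ∧ laplaceExponent X P r = q}

/-- `Pθ` is the Esscher transform of `P` with parameter `θ`: on each `F t` it has the density
`exp (θ (X t - X 0) - ψ(θ) t)` with respect to `P`. -/
def IsEsscherTransform (F : Filtration ℝ≥0 mΩ) (X : ℝ≥0 → Ω → ℝ) (P : Measure Ω)
    (θ : ℝ) (Pθ : Measure Ω) : Prop :=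
  ∀ (t : ℝ≥0) (A : Set Ω), MeasurableSet[F t] A →
    Pθ A = ∫⁻ ω in A,
      ENNReal.ofReal (Real.exp (θ * (X t ω - X 0 ω) - laplaceExponent X P θ * t)) ∂P

/-- `W` is the `q`-scale function of `X` under `P`: it maps into `[0, ∞)`, vanishes on `(-∞, 0)`,
is continuous on `[0, ∞)`, and its Laplace transform is `1 / (ψ - q)` on `(Φ(q), ∞)`. -/
structure IsScaleFunction (X : ℝ≥0 → Ω → ℝ) (P : Measure Ω) (q : ℝ) (W : ℝ → ℝ) : Prop where
  nonneg : ∀ x, 0 ≤ W x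
  eq_zero_of_neg : ∀ x, x < 0 → W x = 0
  continuousOn : ContinuousOn W (Set.Ici 0)
  laplace : ∀ r, laplaceInverse X P q < r →
    ∫⁻ x in Set.Ici (0 : ℝ), ENNReal.ofReal (Real.exp (-r * x) * W x)
      = ENNReal.ofReal (1 / (laplaceExponent X P r - q))

open Classical in
/-- The scale function `W^{(q)}` of `X` under `P`. For a spectrally negative Lévy process and
`q ≥ 0` there is exactly one function as in `IsScaleFunction`; the value `0` is a placeholder
outside of that case. -/
noncomputable def scaleFunction (X : ℝ≥0 → Ω → ℝ) (P : Measure Ω) (q : ℝ) : ℝ → ℝ :=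
  if h : ∃ W, IsScaleFunction X P q W then h.choose else 0

end

/-- `V` is a Borel measurable, locally bounded solution of the convolution equation
`V = W + q W ⋆ (e^{α ·} 1_{[0, ∞)} V)`. -/
structure IsConvolutionSolution (α q : ℝ) (W V : ℝ → ℝ) : Prop where
  measurable : Measurable V
  locally_bounded : ∀ K : Set ℝ, IsCompact K → ∃ C : ℝ, ∀ x ∈ K, |V x| ≤ C
  equation : ∀ x, V x = W x + q *
    (W ⋆[ContinuousLinearMap.mul ℝ ℝ, volume]
      (Set.Ici (0 : ℝ)).indicator (fun u ↦ Real.exp (α * u) * V u)) x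

open Classical in
/-- The solution of the convolution equation. It exists and is unique if `W` is Borel measurable,
locally bounded and vanishes on `(-∞, 0)`; the value `0` is a placeholder outside of that case. -/
noncomputable def convolutionSolution (α q : ℝ) (W : ℝ → ℝ) : ℝ → ℝ :=
  if h : ∃ V, IsConvolutionSolution α q W V then h.choose else 0

/-- The scale function `𝒲^{(q)}_{α,p}(y)`, `y > 0`, of the positive self-similar Markov process
associated, through the Lamperti transform with index `α`, to the process `X` under `P` killed
at rate `p`. -/
noncomputable def pssMpScaleFunction {Ω : Type*} {mΩ : MeasurableSpace Ω}
    (X : ℝ≥0 → Ω → ℝ) (P : Measure Ω) (α p q : ℝ) (y : ℝ) : ℝ :=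
  convolutionSolution α q (scaleFunction X P p) (Real.log y)

end PssMp

/-! The Esscher transform tilts the law of `X 1` by `exp (θ x)`, so where the moments are finite,
`ψ_θ(r) = ψ(r + θ) - ψ(θ)`. Hence `Φ_θ(p - ψ(θ)) = Φ(p) - θ`, and `exp (-θ x) W^{(p)}(x)` has the
Laplace transform that characterises the `(p - ψ(θ))`-scale function under `Pθ`; uniqueness
identifies the two (`IsEsscherTransform.scaleFunction_eq`). Multiplication by an exponential
distributes over convolution, so it carries solutions of the convolution equation for `W` to
solutions for the tilted `W`, and Volterra uniqueness gives `convolutionSolution_exp_mul`. At `x =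
log y` the exponential becomes `y ^ θ`. Nonnegativity of `p - ψ(θ)` is convexity of the
moment-generating function on `[0, Φ(p)]`.

Existence of scale functions or of solutions is never needed: multiplication by an exponential is
invertible, so existence holds on both sides or on neither, and then both placeholders are `0`.
Similarly, the needed finite moments come from `Φ(p) > 0`, and infinite ones are handled through the
default `ψ = 0`. -/

/-! ### Uniqueness for Laplace transforms. -/

/-- Two finite measures on `ℝ` whose moment-generating functions are finite and equal in a
neighbourhood of zero are equal. -/
theorem MeasureTheory.Measure.ext_of_mgf_eventuallyEq {μ ν : Measure ℝ} [IsFiniteMeasure μ]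
    [IsFiniteMeasure ν] (hμ : 0 ∈ interior (integrableExpSet id μ))
    (hν : 0 ∈ interior (integrableExpSet id ν)) (h : mgf id μ =ᶠ[𝓝 0] mgf id ν) : μ = ν := by
  set I := interior (integrableExpSet id μ) ∩ interior (integrableExpSet id ν) with hI
  have hA : AnalyticOnNhd ℂ (complexMGF id μ) {z | z.re ∈ I} :=
    analyticOnNhd_complexMGF.mono fun z hz ↦ hz.1
  have hB : AnalyticOnNhd ℂ (complexMGF id ν) {z | z.re ∈ I} :=
    analyticOnNhd_complexMGF.mono fun z hz ↦ hz.2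
  have hconv : Convex ℝ I := convex_integrableExpSet.interior.inter convex_integrableExpSet.interior
  -- Identity theorem on a vertical strip: equality on the real axis near `0` spreads to the
  -- imaginary axis, where these are the characteristic functions.
  have key : Set.EqOn (complexMGF id μ) (complexMGF id ν) {z | z.re ∈ I} := by
    refine AnalyticOnNhd.eqOn_of_preconnected_of_frequently_eq hA hB
      (hconv.linear_preimage Complex.reLm).isPreconnected (z₀ := 0)
      (by simpa using ⟨hμ, hν⟩) ?_
    have hreal : ∃ᶠ x : ℝ in 𝓝[≠] 0, complexMGF id μ x = complexMGF id ν x := by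
      refine Eventually.frequently ?_
      filter_upwards [h.filter_mono nhdsWithin_le_nhds] with x hx
      rw [complexMGF_ofReal, complexMGF_ofReal, hx]
    have htend : Tendsto ((↑) : ℝ → ℂ) (𝓝[≠] 0) (𝓝[≠] 0) := by
      refine tendsto_nhdsWithin_iff.2 ⟨?_, ?_⟩
      · exact (Complex.continuous_ofReal.tendsto' 0 0 (by simp)).mono_left nhdsWithin_le_nhds
      · filter_upwards [self_mem_nhdsWithin] with x hx
        simpa using hx
    exact htend.frequently hreal
  refine Measure.ext_of_charFun ?_
  ext t
  rw [← complexMGF_id_mul_I, ← complexMGF_id_mul_I]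
  exact key (by simpa using ⟨hμ, hν⟩)

/-- A nonnegative continuous function on `[0, ∞)` is determined by its Laplace transform on a
half-line where the latter is finite. -/
theorem eqOn_of_laplace_eq {f g : ℝ → ℝ} {c : ℝ} (hf0 : ∀ x, 0 ≤ f x) (hg0 : ∀ x, 0 ≤ g x)
    (hf : ContinuousOn f (Set.Ici 0)) (hg : ContinuousOn g (Set.Ici 0))
    (hfin : ∀ r, c < r → ∫⁻ x in Set.Ici (0 : ℝ), ENNReal.ofReal (Real.exp (-r * x) * f x) ≠ ⊤)
    (heq : ∀ r, c < r → ∫⁻ x in Set.Ici (0 : ℝ), ENNReal.ofReal (Real.exp (-r * x) * f x)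
      = ∫⁻ x in Set.Ici (0 : ℝ), ENNReal.ofReal (Real.exp (-r * x) * g x)) :
    Set.EqOn f g (Set.Ici 0) := by
  set lam := (volume : Measure ℝ).restrict (Set.Ici 0) with hlam
  -- The weight with exponent `c + 1` turns the Laplace transform at `c + 1 - t` into a
  -- moment-generating function at `t`, finite for `t < 1` and so near `0`.
  set den : (ℝ → ℝ) → ℝ → ℝ≥0∞ :=
    fun h x ↦ ENNReal.ofReal (Real.exp (-(c + 1) * x) * h x) with hden
  have hden_meas {h : ℝ → ℝ} (hh : ContinuousOn h (Set.Ici 0)) : AEMeasurable (den h) lam :=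
    (ContinuousOn.aemeasurable (by fun_prop) measurableSet_Ici).ennreal_ofReal
  have hlint {h : ℝ → ℝ} (hh : ContinuousOn h (Set.Ici 0)) (t : ℝ) :
      ∫⁻ x, ENNReal.ofReal (Real.exp (t * x)) ∂(lam.withDensity (den h))
        = ∫⁻ x in Set.Ici (0 : ℝ), ENNReal.ofReal (Real.exp (-(c + 1 - t) * x) * h x) := by
    rw [lintegral_withDensity_eq_lintegral_mul₀ (hden_meas hh) (by fun_prop)]
    refine lintegral_congr fun x ↦ ?_
    simp only [hden, Pi.mul_apply]
    rw [mul_comm, ← ENNReal.ofReal_mul (Real.exp_pos _).le, ← mul_assoc, ← Real.exp_add]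
    ring_nf
  have hint {h : ℝ → ℝ} (hh : ContinuousOn h (Set.Ici 0))
      (hfin : ∀ r, c < r →
        ∫⁻ x in Set.Ici (0 : ℝ), ENNReal.ofReal (Real.exp (-r * x) * h x) ≠ ⊤)
      {t : ℝ} (ht : t < 1) :
      t ∈ integrableExpSet id (lam.withDensity (den h)) := by
    refine (lintegral_ofReal_ne_top_iff_integrable
      (f := fun x ↦ Real.exp (t * x)) (by fun_prop) (ae_of_all _ fun x ↦ (Real.exp_pos _).le)).1 ?_
    rw [hlint hh]
    exact hfin _ (by linarith)
  have hinter {h : ℝ → ℝ} (hh : ContinuousOn h (Set.Ici 0))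
      (hfin : ∀ r, c < r →
        ∫⁻ x in Set.Ici (0 : ℝ), ENNReal.ofReal (Real.exp (-r * x) * h x) ≠ ⊤) :
      0 ∈ interior (integrableExpSet id (lam.withDensity (den h))) :=
    mem_interior.2 ⟨Set.Iio 1, fun t ht ↦ hint hh hfin ht, isOpen_Iio, by simp⟩
  have hfinite {h : ℝ → ℝ} (hh : ContinuousOn h (Set.Ici 0))
      (hfin : ∀ r, c < r →
        ∫⁻ x in Set.Ici (0 : ℝ), ENNReal.ofReal (Real.exp (-r * x) * h x) ≠ ⊤) :
      IsFiniteMeasure (lam.withDensity (den h)) :=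
    isFiniteMeasure_withDensity (hfin (c + 1) (by linarith))
  have hfing : ∀ r, c < r →
      ∫⁻ x in Set.Ici (0 : ℝ), ENNReal.ofReal (Real.exp (-r * x) * g x) ≠ ⊤ :=
    fun r hr ↦ heq r hr ▸ hfin r hr
  have := hfinite hf hfin
  have := hfinite hg hfing
  have hmeas : lam.withDensity (den f) = lam.withDensity (den g) := by
    refine Measure.ext_of_mgf_eventuallyEq (hinter hf hfin) (hinter hg hfing) ?_
    filter_upwards [Iio_mem_nhds (zero_lt_one' ℝ)] with t ht
    simp only [mgf, id]
    rw [integral_eq_lintegral_of_nonneg_ae (ae_of_all _ fun x ↦ (Real.exp_pos _).le)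
        (by fun_prop),
      integral_eq_lintegral_of_nonneg_ae (ae_of_all _ fun x ↦ (Real.exp_pos _).le)
        (by fun_prop), hlint hf, hlint hg, heq _ (by simp at ht; linarith)]
  have hae : f =ᵐ[lam] g := by
    filter_upwards [(withDensity_eq_iff (hden_meas hf) (hden_meas hg)
      (hfin (c + 1) (by linarith))).1 hmeas] with x hx
    have := (ENNReal.ofReal_eq_ofReal_iff (mul_nonneg (Real.exp_pos _).le (hf0 x))
      (mul_nonneg (Real.exp_pos _).le (hg0 x))).1 hx
    exact mul_left_cancel₀ (Real.exp_pos _).ne' this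
  exact Measure.eqOn_of_ae_eq hae hf hg (by rw [interior_Ici, closure_Ioi])

/-! ### The Volterra convolution equation. -/

/-- A bounded function satisfying a homogeneous Volterra inequality vanishes. -/
theorem eq_zero_of_abs_le_mul_integral {D : ℝ → ℝ} {T C K : ℝ} (hC : ∀ x ∈ Set.Icc 0 T, |D x| ≤ C)
    (hK0 : 0 ≤ K)
    (hD : ∀ x ∈ Set.Icc 0 T, |D x| ≤ K * ∫ u in Set.Icc 0 x, |D u|) :
    ∀ x ∈ Set.Icc 0 T, D x = 0 := by
  -- Iterating the inequality integrates the previous bound; the factorial wins as `n → ∞`.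
  have bound (n : ℕ) : ∀ x ∈ Set.Icc 0 T, |D x| ≤ C * ((K * x) ^ n / n.factorial) := by
    induction n with
    | zero => simpa using hC
    | succ n ih =>
      intro x hx
      have hmono : ∫ u in Set.Icc 0 x, |D u| ≤
          ∫ u in Set.Icc 0 x, C * ((K * u) ^ n / n.factorial) := by
        refine integral_mono_of_nonneg (ae_of_all _ fun u ↦ abs_nonneg _)
          (Continuous.integrableOn_Icc (by fun_prop)) ?_
        filter_upwards [ae_restrict_mem measurableSet_Icc] with u hu
        exact ih u ⟨hu.1, hu.2.trans hx.2⟩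
      have hval : ∫ u in Set.Icc 0 x, C * ((K * u) ^ n / n.factorial)
          = C * (K ^ n / n.factorial * (x ^ (n + 1) / (n + 1))) := by
        rw [integral_Icc_eq_integral_Ioc, ← intervalIntegral.integral_of_le hx.1]
        simp_rw [mul_pow, mul_div_right_comm]
        simp
      calc |D x| ≤ K * ∫ u in Set.Icc 0 x, |D u| := hD x hx
        _ ≤ K * (C * (K ^ n / n.factorial * (x ^ (n + 1) / (n + 1)))) := by
          rw [← hval]; gcongr
        _ = C * ((K * x) ^ (n + 1) / (n + 1).factorial) := by
          rw [Nat.factorial_succ]; push_cast; field_simp; ring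
  intro x hx
  have hlim : Tendsto (fun n : ℕ ↦ C * ((K * x) ^ n / n.factorial)) atTop (𝓝 0) := by
    simpa using (FloorSemiring.tendsto_pow_div_factorial_atTop (K * x)).const_mul C
  exact abs_nonpos_iff.1 (ge_of_tendsto' hlim fun n ↦ bound n x hx)

namespace PssMp

theorem convolution_mul_indicator_eq {α x : ℝ} {W V : ℝ → ℝ} (hW : ∀ x, x < 0 → W x = 0) :
    (W ⋆[ContinuousLinearMap.mul ℝ ℝ, volume]
      (Set.Ici (0 : ℝ)).indicator (fun u ↦ Real.exp (α * u) * V u)) x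
      = ∫ u in Set.Icc 0 x, W (x - u) * (Real.exp (α * u) * V u) := by
  have h1 : (W ⋆[ContinuousLinearMap.mul ℝ ℝ, volume]
      (Set.Ici (0 : ℝ)).indicator (fun u ↦ Real.exp (α * u) * V u)) x
      = ∫ u, W (x - u) * (Set.Ici (0 : ℝ)).indicator (fun u ↦ Real.exp (α * u) * V u) u :=
    convolution_mul_swap
  rw [h1, ← setIntegral_eq_integral_of_forall_compl_eq_zero (s := Set.Icc 0 x)]
  · refine setIntegral_congr_fun measurableSet_Icc fun u hu ↦ ?_
    simp [Set.indicator_of_mem (Set.mem_Ici.2 hu.1)]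
  · intro u hu
    rcases lt_or_ge u 0 with h | h
    · simp [h]
    · rw [hW (x - u) (by simp [h] at hu; linarith), zero_mul]

/-- Borel measurable, locally bounded solutions of the convolution equation are unique. -/
theorem IsConvolutionSolution.unique {α q : ℝ} {W V₁ V₂ : ℝ → ℝ} (hq : 0 ≤ q)
    (hW : ContinuousOn W (Set.Ici 0)) (hW0 : ∀ x, x < 0 → W x = 0)
    (h₁ : IsConvolutionSolution α q W V₁) (h₂ : IsConvolutionSolution α q W V₂) : V₁ = V₂ := by
  have hWm : Measurable W := by
    have : W = (Set.Ici (0 : ℝ)).piecewise W (fun _ ↦ 0) := by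
      ext x
      by_cases hx : 0 ≤ x
      · simp [hx]
      · simp [hx, hW0 x (not_le.1 hx)]
    rw [this]
    exact hW.measurable_piecewise continuousOn_const measurableSet_Ici
  have hdiff0 (T : ℝ) (hT : 0 ≤ T) : ∀ x ∈ Set.Icc 0 T, (V₁ - V₂) x = 0 := by
    obtain ⟨C₁, hC₁⟩ := h₁.locally_bounded _ (isCompact_Icc (a := 0) (b := T))
    obtain ⟨C₂, hC₂⟩ := h₂.locally_bounded _ (isCompact_Icc (a := 0) (b := T))
    obtain ⟨B, hB⟩ := (isCompact_Icc (a := 0) (b := T)).exists_bound_of_continuousOn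
      (hW.mono Set.Icc_subset_Ici_self)
    obtain ⟨E, hE⟩ := (isCompact_Icc (a := 0) (b := T)).exists_bound_of_continuousOn
      (f := fun u ↦ Real.exp (α * u)) (by fun_prop)
    have hB0 : 0 ≤ B := (norm_nonneg _).trans (hB 0 ⟨le_rfl, hT⟩)
    have hE0 : 0 ≤ E := (norm_nonneg _).trans (hE 0 ⟨le_rfl, hT⟩)
    have hint {V : ℝ → ℝ} {C : ℝ} (hV : Measurable V) (hC : ∀ x ∈ Set.Icc 0 T, |V x| ≤ C)
        {x : ℝ} (hx : x ∈ Set.Icc 0 T) :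
        IntegrableOn (fun u ↦ W (x - u) * (Real.exp (α * u) * V u)) (Set.Icc 0 x) := by
      refine IntegrableOn.of_bound (by simp) (by fun_prop) (B * (E * C)) ?_
      filter_upwards [ae_restrict_mem measurableSet_Icc] with u hu
      have hu' : u ∈ Set.Icc 0 T := ⟨hu.1, hu.2.trans hx.2⟩
      rw [norm_mul, norm_mul]
      gcongr
      · exact hB _ ⟨by linarith [hu.2], by linarith [hu.1, hx.2]⟩
      · exact hE _ hu'
      · exact hC _ hu'
    refine eq_zero_of_abs_le_mul_integral (C := C₁ + C₂) (K := q * (B * E)) ?_ (by positivity) ?_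
    · intro x hx
      exact (abs_sub _ _).trans (add_le_add (hC₁ x hx) (hC₂ x hx))
    · intro x hx
      have hD : (V₁ - V₂) x
          = q * ∫ u in Set.Icc 0 x, W (x - u) * (Real.exp (α * u) * (V₁ - V₂) u) := by
        rw [Pi.sub_apply, h₁.equation x, h₂.equation x, convolution_mul_indicator_eq hW0,
          convolution_mul_indicator_eq hW0, add_sub_add_left_eq_sub, ← mul_sub,
          ← integral_sub (hint h₁.measurable hC₁ hx) (hint h₂.measurable hC₂ hx)]
        simp_rw [Pi.sub_apply, mul_sub]
      rw [hD, abs_mul, abs_of_nonneg hq, mul_assoc]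
      gcongr
      rw [← integral_const_mul, ← Real.norm_eq_abs]
      have hDm : Measurable (V₁ - V₂) := h₁.measurable.sub h₂.measurable
      have hDint : IntegrableOn (fun u ↦ |(V₁ - V₂) u|) (Set.Icc 0 x) := by
        refine IntegrableOn.of_bound (by simp) (by fun_prop) (C₁ + C₂) ?_
        filter_upwards [ae_restrict_mem measurableSet_Icc] with u hu
        have hu' : u ∈ Set.Icc 0 T := ⟨hu.1, hu.2.trans hx.2⟩
        simpa using (abs_sub _ _).trans (add_le_add (hC₁ u hu') (hC₂ u hu'))
      refine norm_integral_le_of_norm_le (hDint.const_mul _) ?_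
      filter_upwards [ae_restrict_mem measurableSet_Icc] with u hu
      have hu' : u ∈ Set.Icc 0 T := ⟨hu.1, hu.2.trans hx.2⟩
      rw [norm_mul, norm_mul, mul_assoc, Real.norm_eq_abs ((V₁ - V₂) u)]
      gcongr
      · exact hB _ ⟨by linarith [hu.2], by linarith [hu.1, hx.2]⟩
      · exact hE _ hu'
  ext x
  rcases lt_or_ge x 0 with hx | hx
  · rw [h₁.equation, h₂.equation, convolution_mul_indicator_eq hW0,
      convolution_mul_indicator_eq hW0]
    simp [Set.Icc_eq_empty (not_le.2 hx)]
  · exact sub_eq_zero.1 (hdiff0 x hx x ⟨hx, le_rfl⟩)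

theorem convolutionSolution_eq {α q : ℝ} {W V : ℝ → ℝ} (hq : 0 ≤ q)
    (hW : ContinuousOn W (Set.Ici 0)) (hW0 : ∀ x, x < 0 → W x = 0)
    (hV : IsConvolutionSolution α q W V) : convolutionSolution α q W = V := by
  have h : ∃ V, IsConvolutionSolution α q W V := ⟨V, hV⟩
  rw [convolutionSolution, dif_pos h]
  exact IsConvolutionSolution.unique hq hW hW0 h.choose_spec hV

theorem IsConvolutionSolution.exp_mul {α q : ℝ} {W V : ℝ → ℝ} (h : IsConvolutionSolution α q W V)
    (θ : ℝ) : IsConvolutionSolution α q (fun x ↦ Real.exp (θ * x) * W x)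
      (fun x ↦ Real.exp (θ * x) * V x) where
  measurable := by have := h.measurable; fun_prop
  locally_bounded K hK := by
    obtain ⟨C, hC⟩ := h.locally_bounded K hK
    obtain ⟨E, hE⟩ := hK.exists_bound_of_continuousOn
      (f := fun u ↦ Real.exp (θ * u)) (by fun_prop)
    refine ⟨E * C, fun x hx ↦ ?_⟩
    rw [abs_mul]
    exact mul_le_mul (hE x hx) (hC x hx) (abs_nonneg _) ((norm_nonneg _).trans (hE x hx))
  equation x := by
    rw [h.equation x, mul_add, mul_left_comm]
    congr 2
    simp only [convolution_def, ContinuousLinearMap.mul_apply']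
    rw [← integral_const_mul]
    congr 1 with t
    -- For `t > x` the indicator kills both sides; otherwise the exponential splits along `x = t +
    -- (x - t)`.
    by_cases ht : t ≤ x
    · have : Real.exp (θ * x) = Real.exp (θ * t) * Real.exp (θ * (x - t)) := by
        rw [← Real.exp_add]; ring_nf
      simp only [Set.indicator_of_mem (Set.mem_Ici.2 (sub_nonneg.2 ht)), this]
      ring
    · simp [ht]

theorem convolutionSolution_exp_mul {α q : ℝ} {W : ℝ → ℝ} (hq : 0 ≤ q)
    (hW : ContinuousOn W (Set.Ici 0)) (hW0 : ∀ x, x < 0 → W x = 0) (θ x : ℝ) :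
    convolutionSolution α q (fun x ↦ Real.exp (θ * x) * W x) x
      = Real.exp (θ * x) * convolutionSolution α q W x := by
  by_cases h : ∃ V, IsConvolutionSolution α q W V
  · obtain ⟨V, hV⟩ := h
    rw [convolutionSolution_eq hq hW hW0 hV, convolutionSolution_eq hq (by fun_prop)
      (fun x hx ↦ by rw [hW0 x hx, mul_zero]) (hV.exp_mul θ)]
  · have h' : ¬ ∃ V, IsConvolutionSolution α q (fun x ↦ Real.exp (θ * x) * W x) V := by
      rintro ⟨V, hV⟩
      refine h ⟨fun x ↦ Real.exp (-θ * x) * V x, ?_⟩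
      convert hV.exp_mul (-θ) using 2 with x
      rw [← mul_assoc, ← Real.exp_add]
      simp
    rw [convolutionSolution, dif_neg h', convolutionSolution, dif_neg h]
    simp

/-! ### Exponential tilting of `ψ` and `Φ`. -/

section Esscher

variable {Ω : Type*} {mΩ : MeasurableSpace Ω} {F : Filtration ℝ≥0 mΩ} {X : ℝ≥0 → Ω → ℝ}

theorem IsSpectrallyNegativeLevy.measurable {P : Measure Ω}
    (hX : IsSpectrallyNegativeLevy F X P) (t : ℝ≥0) : Measurable (X t) :=
  (hX.adapted t).mono (F.le t) le_rfl

variable {P Pθ : Measure Ω} {θ p r : ℝ}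

/-- The Esscher transform tilts the law of `X 1` exponentially. -/
theorem IsEsscherTransform.map_eq (hX : IsSpectrallyNegativeLevy F X P)
    (hPθ : IsEsscherTransform F X P θ Pθ) (hθ : Integrable (fun ω ↦ Real.exp (θ * X 1 ω)) P) :
    Pθ.map (X 1) = (P.tilted (θ * X 1 ·)).map (X 1) := by
  ext s hs
  have hm := hX.adapted 1 hs
  rw [Measure.map_apply (hX.measurable 1) hs, Measure.map_apply (hX.measurable 1) hs,
    hPθ 1 _ hm, tilted_mul_apply_cgf' (F.le 1 _ hm) hθ]
  refine lintegral_congr_ae (ae_restrict_of_ae ?_)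
  filter_upwards [hX.start_zero] with ω hω
  simp [hω, laplaceExponent]

theorem IsEsscherTransform.mgf_eq (hX : IsSpectrallyNegativeLevy F X P)
    (hPθ : IsEsscherTransform F X P θ Pθ) (hθ : Integrable (fun ω ↦ Real.exp (θ * X 1 ω)) P) :
    mgf (X 1) Pθ r = mgf (X 1) P (r + θ) / mgf (X 1) P θ := by
  rw [← mgf_id_map (hX.measurable 1).aemeasurable, hPθ.map_eq hX hθ,
    mgf_id_map (hX.measurable 1).aemeasurable, mgf, integral_tilted_mul_eq_mgf,
    mgf.eq_1 _ _ (r + θ), ← integral_div]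
  congr 1 with ω
  rw [smul_eq_mul, add_mul, Real.exp_add]
  ring

theorem IsEsscherTransform.laplaceExponent_eq_zero (hX : IsSpectrallyNegativeLevy F X P)
    (hPθ : IsEsscherTransform F X P θ Pθ) (hθ : Integrable (fun ω ↦ Real.exp (θ * X 1 ω)) P)
    (hr : ¬ Integrable (fun ω ↦ Real.exp ((r + θ) * X 1 ω)) P) :
    laplaceExponent X Pθ r = 0 := by
  simp only [laplaceExponent, cgf]
  rw [hPθ.mgf_eq hX hθ, mgf_undef hr, zero_div, Real.log_zero]

variable [IsProbabilityMeasure P]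

theorem IsEsscherTransform.laplaceExponent_eq (hX : IsSpectrallyNegativeLevy F X P)
    (hPθ : IsEsscherTransform F X P θ Pθ) (hθ : Integrable (fun ω ↦ Real.exp (θ * X 1 ω)) P)
    (hr : Integrable (fun ω ↦ Real.exp ((r + θ) * X 1 ω)) P) :
    laplaceExponent X Pθ r = laplaceExponent X P (r + θ) - laplaceExponent X P θ := by
  simp only [laplaceExponent, cgf]
  rw [hPθ.mgf_eq hX hθ, Real.log_div (mgf_pos hr).ne' (mgf_pos hθ).ne']

/-- If `Φ(0) > 0`, then all positive exponential moments of `X 1` are finite. -/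
theorem integrable_exp_of_laplaceInverse_zero_pos (hΦ : 0 < laplaceInverse X P 0) (hr : 0 ≤ r) :
    Integrable (fun ω ↦ Real.exp (r * X 1 ω)) P := by
  by_contra h
  -- One infinite moment makes all higher ones infinite, so `ψ` takes its default value `0` on a
  -- half-line and the supremum of its zeros defaults to `0`.
  refine hΦ.ne' (Real.sSup_of_not_bddAbove ?_)
  rintro ⟨b, hb⟩
  have hmem : max r (b + 1) ∈ {r : ℝ | 0 ≤ r ∧ laplaceExponent X P r = 0} :=
    ⟨hr.trans (le_max_left _ _), cgf_undef fun hi ↦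
      h (integrable_exp_mul_of_nonneg_of_le hi hr (le_max_left _ _))⟩
  linarith [hb hmem, le_max_right r (b + 1)]

/-- If `Φ(p) > 0`, then it is the largest solution of `ψ = p`, and the exponential moment of `X 1`
of this order is finite. -/
theorem isGreatest_laplaceInverse (hm : Measurable (X 1)) (hp : 0 ≤ p)
    (hΦ : 0 < laplaceInverse X P p) :
    Integrable (fun ω ↦ Real.exp (laplaceInverse X P p * X 1 ω)) P ∧
      IsGreatest {r : ℝ | 0 ≤ r ∧ laplaceExponent X P r = p} (laplaceInverse X P p) := by
  set S := {r : ℝ | 0 ≤ r ∧ laplaceExponent X P r = p} with hS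
  set b := laplaceInverse X P p with hb
  have hne : S.Nonempty := by
    by_contra h
    rw [Set.not_nonempty_iff_eq_empty] at h
    exact hΦ.ne' (by rw [hb, laplaceInverse, ← hS, h, Real.sSup_empty])
  have hbdd : BddAbove S := by
    by_contra h
    exact hΦ.ne' (Real.sSup_of_not_bddAbove h)
  have hSint : ∀ r ∈ S, Integrable (fun ω ↦ Real.exp (r * X 1 ω)) P := by
    intro r hr
    rcases hp.eq_or_lt with rfl | hp'
    · exact integrable_exp_of_laplaceInverse_zero_pos hΦ hr.1
    · by_contra h
      exact hp'.ne' (hr.2 ▸ cgf_undef h)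
  have hSmgf : ∀ r ∈ S, mgf (X 1) P r = Real.exp p := fun r hr ↦ by
    rw [← exp_cgf (hSint r hr), ← hr.2, laplaceExponent]
  obtain ⟨u, -, hub, huS⟩ := exists_seq_tendsto_sSup hne hbdd
  change Tendsto u atTop (𝓝 b) at hub
  have hpt (ω : Ω) : Tendsto (fun n ↦ Real.exp (u n * X 1 ω)) atTop (𝓝 (Real.exp (b * X 1 ω))) :=
    (Real.continuous_exp.tendsto _).comp (hub.mul_const _)
  have hlint (n : ℕ) : ∫⁻ ω, ENNReal.ofReal (Real.exp (u n * X 1 ω)) ∂P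
      = ENNReal.ofReal (Real.exp p) := by
    rw [← ofReal_integral_eq_lintegral_ofReal (hSint _ (huS n))
      (ae_of_all _ fun ω ↦ (Real.exp_pos _).le), ← hSmgf _ (huS n), mgf]
  -- Fatou along solutions `u n → b` gives finiteness; dominated convergence then shows that the
  -- supremum is attained.
  have hbint : Integrable (fun ω ↦ Real.exp (b * X 1 ω)) P := by
    refine (lintegral_ofReal_ne_top_iff_integrable (by fun_prop)
      (ae_of_all _ fun ω ↦ (Real.exp_pos _).le)).1 (ne_top_of_le_ne_top
        (ENNReal.ofReal_ne_top (r := Real.exp p)) ?_)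
    calc ∫⁻ ω, ENNReal.ofReal (Real.exp (b * X 1 ω)) ∂P
        = ∫⁻ ω, liminf (fun n ↦ ENNReal.ofReal (Real.exp (u n * X 1 ω))) atTop ∂P :=
          lintegral_congr fun ω ↦ (ENNReal.tendsto_ofReal (hpt ω)).liminf_eq.symm
      _ ≤ liminf (fun n ↦ ∫⁻ ω, ENNReal.ofReal (Real.exp (u n * X 1 ω)) ∂P) atTop :=
          lintegral_liminf_le fun n ↦ by fun_prop
      _ = ENNReal.ofReal (Real.exp p) := by simp [hlint]
  have hmgf : mgf (X 1) P b = Real.exp p := by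
    refine tendsto_nhds_unique (f := fun n ↦ mgf (X 1) P (u n)) (l := atTop) ?_ ?_
    · refine tendsto_integral_of_dominated_convergence (fun ω ↦ 1 + Real.exp (b * X 1 ω))
        (fun n ↦ by fun_prop) ((integrable_const 1).add hbint) (fun n ↦ ae_of_all _ fun ω ↦ ?_)
        (ae_of_all _ hpt)
      rw [Real.norm_of_nonneg (Real.exp_pos _).le]
      rcases le_total 0 (X 1 ω) with h | h
      · have : Real.exp (u n * X 1 ω) ≤ Real.exp (b * X 1 ω) :=
          Real.exp_le_exp.2 (mul_le_mul_of_nonneg_right (le_csSup hbdd (huS n)) h)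
        linarith
      · have : Real.exp (u n * X 1 ω) ≤ 1 :=
          Real.exp_le_one_iff.2 (mul_nonpos_of_nonneg_of_nonpos (huS n).1 h)
        linarith [Real.exp_pos (b * X 1 ω)]
    · simp_rw [hSmgf _ (huS _)]
      exact tendsto_const_nhds
  exact ⟨hbint, ⟨hΦ.le, by rw [laplaceExponent, cgf, hmgf, Real.log_exp]⟩,
    fun r hr ↦ le_csSup hbdd hr⟩

/-- Convexity of the moment-generating function, between `0` and `b`. -/
theorem mgf_le_of_mem_Icc {Y : Ω → ℝ} {b : ℝ} (hb : 0 < b) (hθ : θ ∈ Set.Icc 0 b)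
    (hint : Integrable (fun ω ↦ Real.exp (b * Y ω)) P) :
    mgf Y P θ ≤ 1 - θ / b + θ / b * mgf Y P b := by
  have hs0 : 0 ≤ θ / b := div_nonneg hθ.1 hb.le
  have hs1 : θ / b ≤ 1 := (div_le_one hb).2 hθ.2
  have hle (ω : Ω) : Real.exp (θ * Y ω) ≤ 1 - θ / b + θ / b * Real.exp (b * Y ω) := by
    have := convexOn_exp.2 (Set.mem_univ 0) (Set.mem_univ (b * Y ω)) (sub_nonneg.2 hs1) hs0
      (sub_add_cancel _ _)
    have he : θ / b * (b * Y ω) = θ * Y ω := by field_simp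
    simpa [he] using this
  calc mgf Y P θ ≤ ∫ ω, (1 - θ / b + θ / b * Real.exp (b * Y ω)) ∂P :=
        integral_mono (integrable_exp_mul_of_nonneg_of_le hint hθ.1 hθ.2)
          ((integrable_const _).add (hint.const_mul _)) hle
    _ = 1 - θ / b + θ / b * mgf Y P b := by
        rw [integral_add (integrable_const _) (hint.const_mul _), integral_const_mul]
        simp [mgf]

theorem integrable_exp_of_le_laplaceInverse (hm : Measurable (X 1)) (hp : 0 ≤ p) (hθ : 0 ≤ θ)
    (hθΦ : θ ≤ laplaceInverse X P p) : Integrable (fun ω ↦ Real.exp (θ * X 1 ω)) P := by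
  rcases hθ.eq_or_lt with rfl | hθ'
  · simp
  · exact integrable_exp_mul_of_nonneg_of_le
      (isGreatest_laplaceInverse hm hp (hθ'.trans_le hθΦ)).1 hθ hθΦ

theorem mgf_laplaceInverse (hm : Measurable (X 1)) (hp : 0 ≤ p) (hΦ : 0 < laplaceInverse X P p) :
    mgf (X 1) P (laplaceInverse X P p) = Real.exp p := by
  have h := isGreatest_laplaceInverse hm hp hΦ
  rw [← exp_cgf h.1]
  exact congrArg Real.exp h.2.1.2

/-- By convexity, the moment-generating function lies below the chord from `1` at `0` to `exp p ≥ 1`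
at `Φ(p)`. -/
theorem laplaceExponent_le_of_le_laplaceInverse (hm : Measurable (X 1)) (hp : 0 ≤ p) (hθ : 0 ≤ θ)
    (hθΦ : θ ≤ laplaceInverse X P p) : laplaceExponent X P θ ≤ p := by
  rcases hθ.eq_or_lt with rfl | hθ'
  · simpa [laplaceExponent] using hp
  have hΦ := hθ'.trans_le hθΦ
  have h := mgf_le_of_mem_Icc hΦ ⟨hθ, hθΦ⟩ (isGreatest_laplaceInverse hm hp hΦ).1
  rw [mgf_laplaceInverse hm hp hΦ] at h
  have hs1 : θ / laplaceInverse X P p ≤ 1 := (div_le_one hΦ).2 hθΦ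
  rw [laplaceExponent, cgf, Real.log_le_iff_le_exp
    (mgf_pos (integrable_exp_of_le_laplaceInverse hm hp hθ hθΦ))]
  nlinarith [Real.one_le_exp hp]

theorem laplaceExponent_lt_of_lt_laplaceInverse (hm : Measurable (X 1)) (hp : 0 < p) (hθ : 0 ≤ θ)
    (hθΦ : θ < laplaceInverse X P p) : laplaceExponent X P θ < p := by
  have hΦ := hθ.trans_lt hθΦ
  have h := mgf_le_of_mem_Icc hΦ ⟨hθ, hθΦ.le⟩ (isGreatest_laplaceInverse hm hp.le hΦ).1
  rw [mgf_laplaceInverse hm hp.le hΦ] at h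
  have hs1 : θ / laplaceInverse X P p < 1 := (div_lt_one hΦ).2 hθΦ
  rw [laplaceExponent, cgf, Real.log_lt_iff_lt_exp
    (mgf_pos (integrable_exp_of_le_laplaceInverse hm hp.le hθ hθΦ.le))]
  nlinarith [Real.one_lt_exp_iff.2 hp]

/-- Under the Esscher transform, `Φ` is shifted by `θ`. -/
theorem IsEsscherTransform.laplaceInverse_eq (hX : IsSpectrallyNegativeLevy F X P)
    (hPθ : IsEsscherTransform F X P θ Pθ) (hp : 0 ≤ p) (hθ : 0 ≤ θ)
    (hθΦ : θ ≤ laplaceInverse X P p) :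
    laplaceInverse X Pθ (p - laplaceExponent X P θ) = laplaceInverse X P p - θ := by
  have hm := hX.measurable 1
  have hint := integrable_exp_of_le_laplaceInverse hm hp hθ hθΦ
  rcases hθ.eq_or_lt with rfl | hθ'
  · have hψ (r : ℝ) : laplaceExponent X Pθ r = laplaceExponent X P r := by
      simp [laplaceExponent, cgf, hPθ.mgf_eq hX hint]
    simp only [laplaceInverse, hψ, sub_zero]
    simp [laplaceExponent]
  have hΦ := hθ'.trans_le hθΦ
  obtain ⟨hΦint, hgr⟩ := isGreatest_laplaceInverse hm hp hΦ
  by_cases hall : ∀ r, 0 ≤ r → laplaceExponent X Pθ r = p - laplaceExponent X P θ →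
      Integrable (fun ω ↦ Real.exp ((r + θ) * X 1 ω)) P
  · refine IsGreatest.csSup_eq ⟨⟨sub_nonneg.2 hθΦ, ?_⟩, ?_⟩
    · rw [hPθ.laplaceExponent_eq hX hint (by rwa [sub_add_cancel]), sub_add_cancel, hgr.1.2]
    · rintro r ⟨hr0, hr⟩
      refine le_sub_iff_add_le.2 (hgr.2 ⟨by linarith, ?_⟩)
      linarith [hPθ.laplaceExponent_eq hX hint (hall r hr0 hr)]
  -- A spurious solution, from the default `ψ_θ(r) = 0`, forces `ψ(θ) = p` with `p > 0`, hence `θ =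
  -- Φ(p)` by the strict bound. Then both sides are `0`, the left one as the supremum of an
  -- unbounded set.
  · push Not at hall
    obtain ⟨r, hr0, hr, hrint⟩ := hall
    have hp0 : p ≠ 0 := by
      rintro rfl
      exact hrint (integrable_exp_of_laplaceInverse_zero_pos hΦ (by linarith))
    have hψθ : p - laplaceExponent X P θ = 0 := by
      rw [← hr, hPθ.laplaceExponent_eq_zero hX hint hrint]
    have hθeq : θ = laplaceInverse X P p := by
      by_contra hne
      linarith [laplaceExponent_lt_of_lt_laplaceInverse hm (hp.lt_of_ne' hp0) hθ
        (lt_of_le_of_ne hθΦ hne)]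
    rw [← hθeq, sub_self, hψθ]
    refine Real.sSup_of_not_bddAbove ?_
    rintro ⟨b, hb⟩
    have hmem : max r (b + 1) ∈ {r : ℝ | 0 ≤ r ∧ laplaceExponent X Pθ r = 0} :=
      ⟨hr0.trans (le_max_left _ _), hPθ.laplaceExponent_eq_zero hX hint fun hi ↦
        hrint (integrable_exp_mul_of_nonneg_of_le hi (by linarith)
          (by linarith [le_max_left r (b + 1)]))⟩
    linarith [hb hmem, le_max_right r (b + 1)]

/-- The Laplace transforms `1 / (ψ - p)` of the scale functions under `P` and under the Esscher
transform are shifts of each other. -/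
theorem IsEsscherTransform.ofReal_one_div_eq (hX : IsSpectrallyNegativeLevy F X P)
    (hPθ : IsEsscherTransform F X P θ Pθ) (hp : 0 ≤ p) (hθ : 0 ≤ θ)
    (hθΦ : θ ≤ laplaceInverse X P p) :
    ENNReal.ofReal (1 / (laplaceExponent X Pθ r - (p - laplaceExponent X P θ)))
      = ENNReal.ofReal (1 / (laplaceExponent X P (r + θ) - p)) := by
  have hm := hX.measurable 1
  have hint := integrable_exp_of_le_laplaceInverse hm hp hθ hθΦ
  by_cases hr : Integrable (fun ω ↦ Real.exp ((r + θ) * X 1 ω)) P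
  · rw [hPθ.laplaceExponent_eq hX hint hr]
    ring_nf
  -- With an infinite moment both exponents default to `0`; as `p ≥ 0` and `ψ(θ) ≤ p`, both
  -- reciprocals are nonpositive and truncate to `0`.
  · have hle := laplaceExponent_le_of_le_laplaceInverse hm hp hθ hθΦ
    rw [hPθ.laplaceExponent_eq_zero hX hint hr,
      show laplaceExponent X P (r + θ) = 0 from cgf_undef hr,
      ENNReal.ofReal_of_nonpos (one_div_nonpos.2 (by linarith)),
      ENNReal.ofReal_of_nonpos (one_div_nonpos.2 (by linarith))]

/-- Multiplication by `exp (-θ x)` turns `p`-scale functions under `P` into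
`(p - ψ(θ))`-scale functions under the Esscher transform, and conversely. -/
theorem IsEsscherTransform.isScaleFunction_iff (hX : IsSpectrallyNegativeLevy F X P)
    (hPθ : IsEsscherTransform F X P θ Pθ) (hp : 0 ≤ p) (hθ : 0 ≤ θ)
    (hθΦ : θ ≤ laplaceInverse X P p) {W : ℝ → ℝ} :
    IsScaleFunction X Pθ (p - laplaceExponent X P θ) (fun x ↦ Real.exp (-θ * x) * W x)
      ↔ IsScaleFunction X P p W := by
  have hexp (r x : ℝ) : Real.exp (-r * x) * (Real.exp (-θ * x) * W x)
      = Real.exp (-(r + θ) * x) * W x := by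
    rw [← mul_assoc, ← Real.exp_add]
    ring_nf
  constructor
  · rintro ⟨h1, h2, h3, h4⟩
    refine ⟨fun x ↦ nonneg_of_mul_nonneg_right (h1 x) (Real.exp_pos _),
      fun x hx ↦ (mul_eq_zero.1 (h2 x hx)).resolve_left (Real.exp_pos _).ne', ?_, fun r hr ↦ ?_⟩
    · refine (ContinuousOn.mul (f := fun x ↦ Real.exp (θ * x)) (by fun_prop) h3).congr
        fun x _ ↦ ?_
      rw [Pi.mul_apply, ← mul_assoc, ← Real.exp_add]
      simp
    · have := h4 (r - θ) (by rw [hPθ.laplaceInverse_eq hX hp hθ hθΦ]; linarith)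
      simpa only [hexp, hPθ.ofReal_one_div_eq hX hp hθ hθΦ, sub_add_cancel] using this
  · rintro ⟨h1, h2, h3, h4⟩
    refine ⟨fun x ↦ mul_nonneg (Real.exp_pos _).le (h1 x), fun x hx ↦ by rw [h2 x hx, mul_zero],
      by fun_prop, fun r hr ↦ ?_⟩
    rw [hPθ.laplaceInverse_eq hX hp hθ hθΦ] at hr
    simp only [hexp, hPθ.ofReal_one_div_eq hX hp hθ hθΦ]
    exact h4 (r + θ) (by linarith)

end Esscher

/-! ### Uniqueness and tilting of scale functions. -/

section ScaleFunction

variable {Ω : Type*} {mΩ : MeasurableSpace Ω} {X : ℝ≥0 → Ω → ℝ} {P : Measure Ω} {p : ℝ}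

theorem IsScaleFunction.unique {V W : ℝ → ℝ} (hV : IsScaleFunction X P p V)
    (hW : IsScaleFunction X P p W) : V = W := by
  ext x
  rcases lt_or_ge x 0 with hx | hx
  · rw [hV.eq_zero_of_neg x hx, hW.eq_zero_of_neg x hx]
  · refine eqOn_of_laplace_eq hV.nonneg hW.nonneg hV.continuousOn hW.continuousOn
      (c := laplaceInverse X P p) (fun r hr ↦ ?_) (fun r hr ↦ ?_) hx
    · rw [hV.laplace r hr]
      exact ENNReal.ofReal_ne_top
    · rw [hV.laplace r hr, hW.laplace r hr]

theorem scaleFunction_eq {W : ℝ → ℝ} (hW : IsScaleFunction X P p W) : scaleFunction X P p = W := by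
  have h : ∃ W, IsScaleFunction X P p W := ⟨W, hW⟩
  rw [scaleFunction, dif_pos h]
  exact h.choose_spec.unique hW

theorem continuousOn_scaleFunction : ContinuousOn (scaleFunction X P p) (Set.Ici 0) := by
  rw [scaleFunction]
  split_ifs with h
  · exact h.choose_spec.continuousOn
  · exact continuousOn_const

theorem scaleFunction_of_neg {x : ℝ} (hx : x < 0) : scaleFunction X P p x = 0 := by
  rw [scaleFunction]
  split_ifs with h
  · exact h.choose_spec.eq_zero_of_neg x hx
  · rfl

theorem IsEsscherTransform.scaleFunction_eq [IsProbabilityMeasure P] {Pθ : Measure Ω}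
    {F : Filtration ℝ≥0 mΩ} {θ : ℝ} (hX : IsSpectrallyNegativeLevy F X P)
    (hPθ : IsEsscherTransform F X P θ Pθ) (hp : 0 ≤ p) (hθ : 0 ≤ θ)
    (hθΦ : θ ≤ laplaceInverse X P p) :
    scaleFunction X Pθ (p - laplaceExponent X P θ)
      = fun x ↦ Real.exp (-θ * x) * scaleFunction X P p x := by
  by_cases h : ∃ W, IsScaleFunction X P p W
  · obtain ⟨W, hW⟩ := h
    rw [PssMp.scaleFunction_eq hW,
      PssMp.scaleFunction_eq ((hPθ.isScaleFunction_iff hX hp hθ hθΦ).2 hW)]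
  · have h' : ¬ ∃ W, IsScaleFunction X Pθ (p - laplaceExponent X P θ) W := by
      rintro ⟨W, hW⟩
      refine h ⟨fun x ↦ Real.exp (θ * x) * W x, (hPθ.isScaleFunction_iff hX hp hθ hθΦ).1 ?_⟩
      convert hW using 2 with x
      rw [← mul_assoc, ← Real.exp_add]
      simp
    rw [scaleFunction, dif_neg h', scaleFunction, dif_neg h]
    ext x
    simp

end ScaleFunction

end PssMp

theorem proposition3p3 {Ω : Type*} {mΩ : MeasurableSpace Ω}
    (P Pθ : Measure Ω) [IsProbabilityMeasure P]
    (F : Filtration ℝ≥0 mΩ) (X : ℝ≥0 → Ω → ℝ)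
    (hX : PssMp.IsSpectrallyNegativeLevy F X P)
    (α p q θ : ℝ) (hp : 0 ≤ p) (hq : 0 ≤ q)
    (hθ : 0 ≤ θ) (hθΦ : θ ≤ PssMp.laplaceInverse X P p)
    (hPθ : PssMp.IsEsscherTransform F X P θ Pθ) :
    0 ≤ p - PssMp.laplaceExponent X P θ ∧
    ∀ y : ℝ, 0 < y →
      PssMp.pssMpScaleFunction X P α p q y =
        PssMp.pssMpScaleFunction X Pθ α (p - PssMp.laplaceExponent X P θ) q y * y ^ θ := by
  refine ⟨sub_nonneg.2
    (PssMp.laplaceExponent_le_of_le_laplaceInverse (hX.measurable 1) hp hθ hθΦ), fun y hy ↦ ?_⟩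
  rw [PssMp.pssMpScaleFunction, PssMp.pssMpScaleFunction, hPθ.scaleFunction_eq hX hp hθ hθΦ,
    PssMp.convolutionSolution_exp_mul hq PssMp.continuousOn_scaleFunction
      (fun x hx ↦ PssMp.scaleFunction_of_neg hx), Real.rpow_def_of_pos hy, mul_right_comm,
    ← Real.exp_add, mul_comm (Real.log y)]
  simp
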